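/- Let $R$ be a regular commutative ring, that is, a commutative Noetherian ring whose localization $R_P$ at every prime ideal $P$ is a regular local ring, and let $E$ be an $R$-module. Suppose that $\operatorname{Ext}^1_R(R/J, E) = 0$ for every ideal $J$ of $R$ generated by an $R$-regular sequence, i.e. $J = (x_1,\dots,x_g)$ with $J \neq R$ and $x_i$ a nonzerodivisor on $R/(x_1,\dots,x_{i-1})$ for $i = 1,\dots,g$. Then $E$ is an injective $R$-module. -/

import Mathlib

universe u

open CategoryTheory Abelian IsLocalRing RingTheory.Sequence

/-! It suffices that every essential extension `Q` of `E` is trivial. Otherwise `Q/E` has an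
associated prime `P`, the annihilator of the class of some `c`. Regularity gives an ideal `J ≤ P`
generated by a regular sequence and `s ∉ P` with `sP ⊆ J`. As Ext¹ of `R/J` vanishes, the map `j ↦ j
c` from `J` to `E` is multiplication by some `e`, so `y = c - e` is killed by `J` and still has
annihilator `P` modulo `E`. Then `s y ≠ 0`, and essentiality gives `r` with `r s y` nonzero in `E`.
Hence `r s ∈ P`, so `r ∈ P` and `s r ∈ J` kills `y`, a contradiction.

The ideal `J` comes from prime avoidance: `P` yields `ht P` elements that form a regular sequence
and generate the maximal ideal of `R_P`. Regularity holds because a regular local ring has depth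
equal to its dimension. -/

/-! ### Injectivity from essential extensions -/

lemma Ideal.exists_smul_eq_of_subsingleton_ext {R : Type u} [CommRing R] {E : Type u}
    [AddCommGroup E] [Module R E] (J : Ideal R)
    (h : Subsingleton (Ext (ModuleCat.of R (R ⧸ J)) (ModuleCat.of R E) 1)) (g : J →ₗ[R] E) :
    ∃ e : E, ∀ j : J, g j = (j : R) • e := by
  let S : ShortComplex (ModuleCat.{u} R) :=
    ModuleCat.shortComplexOfCompEqZero J.subtype J.mkQ
      (LinearMap.exact_subtype_mkQ J).linearMap_comp_eq_zero
  have hS : S.ShortExact := ModuleCat.shortComplex_shortExact S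
    (LinearMap.exact_subtype_mkQ J) J.injective_subtype (Submodule.mkQ_surjective _)
  obtain ⟨x, hx⟩ := Ext.contravariant_sequence_exact₁ hS (Y := ModuleCat.of R E)
    (Ext.mk₀ (ModuleCat.ofHom g)) (n₁ := 1) rfl (h.elim _ _)
  obtain ⟨φ, rfl⟩ := Ext.addEquiv₀.symm.surjective x
  have hφ : S.f ≫ φ = ModuleCat.ofHom g := by
    apply Ext.addEquiv₀.symm.injective
    simpa using hx
  refine ⟨φ.hom (1 : R), fun j ↦ ?_⟩
  rw [← map_smul φ.hom]
  have := ConcreteCategory.congr_hom hφ j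
  simp [S] at this
  simp [← this]

/-- Embed `E` in an injective `I` and let `N` be maximal among submodules meeting `E` trivially.
Then `I ⧸ N` is essential over `E`, hence equal to it, and `E` is a retract of `I`. -/
lemma Module.injective_of_forall_essential_surjective {R : Type u} [CommRing R] {E : Type u}
    [AddCommGroup E] [Module R E]
    (h : ∀ (Q : Type u) [AddCommGroup Q] [Module R Q] (f : E →ₗ[R] Q), Function.Injective f →
      (∀ z : Q, z ≠ 0 → ∃ r : R, r • z ≠ 0 ∧ r • z ∈ LinearMap.range f) →
      Function.Surjective f) :
    Module.Injective R E := by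
  let ⟨I, hI, i', _⟩ := EnoughInjectives.presentation (ModuleCat.of R E)
  have : Module.Injective R I := Module.injective_module_of_injective_object R I
  let i : E →ₗ[R] I := i'.hom
  have hi : Function.Injective i := (ModuleCat.mono_iff_injective i').mp ‹_›
  obtain ⟨N, hN⟩ : ∃ N : Submodule R I, Maximal (fun N ↦ Disjoint N (LinearMap.range i)) N := by
    refine (zorn_le_nonempty₀ {N : Submodule R I | Disjoint N (LinearMap.range i)}
      (fun c hc hchain y hy ↦ ⟨sSup c, ?_, fun z hz ↦ le_sSup hz⟩) ⊥ disjoint_bot_left).imp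
      fun N hN ↦ hN.2
    rw [Set.mem_ofPred_eq, Submodule.disjoint_def]
    intro x hx hx'
    rw [Submodule.mem_sSup_of_directed ⟨y, hy⟩ hchain.directedOn] at hx
    obtain ⟨z, hz, hxz⟩ := hx
    exact Submodule.disjoint_def.mp (hc hz) x hxz hx'
  let f : E →ₗ[R] I ⧸ N := N.mkQ ∘ₗ i
  have hf : Function.Injective f := by
    rw [← LinearMap.ker_eq_bot, LinearMap.ker_eq_bot']
    intro e he
    apply hi
    rw [map_zero]
    exact Submodule.disjoint_def.mp hN.prop _ (by simpa [f] using he) ⟨e, rfl⟩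
  have hess : ∀ z : I ⧸ N, z ≠ 0 → ∃ r : R, r • z ≠ 0 ∧ r • z ∈ LinearMap.range f := by
    intro z hz
    obtain ⟨z, rfl⟩ := N.mkQ_surjective z
    have hzN : z ∉ N := by simpa using hz
    have hnd : ¬ Disjoint (N ⊔ Submodule.span R {z}) (LinearMap.range i) := fun hd ↦
      hzN (hN.le_of_ge hd le_sup_left
        (Submodule.mem_sup_right (Submodule.mem_span_singleton_self z)))
    rw [Submodule.disjoint_def] at hnd
    push Not at hnd
    obtain ⟨_, hx, ⟨e, rfl⟩, he0⟩ := hnd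
    obtain ⟨n, hn, w, hw, hnw⟩ := Submodule.mem_sup.mp hx
    obtain ⟨r, rfl⟩ := Submodule.mem_span_singleton.mp hw
    have hfe : f e = r • N.mkQ z := by
      simp [f, ← hnw, (Submodule.Quotient.mk_eq_zero N).mpr hn]
    refine ⟨r, ?_, e, hfe⟩
    rw [← hfe, Ne, map_eq_zero_iff f hf]
    rintro rfl
    exact he0 (map_zero i)
  let F := LinearEquiv.ofBijective f ⟨hf, h _ f hf hess⟩
  rw [← Module.Baer.iff_injective]
  intro J g
  obtain ⟨g', hg'⟩ := Module.Baer.iff_injective.mpr this J (i ∘ₗ g)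
  refine ⟨F.symm.toLinearMap ∘ₗ N.mkQ ∘ₗ g', fun x hx ↦ ?_⟩
  simp only [LinearMap.comp_apply, LinearEquiv.coe_coe, hg' x hx]
  exact F.symm_apply_apply _

lemma Module.injective_of_forall_prime_exists_ideal {R : Type u} [CommRing R]
    [IsNoetherianRing R] {E : Type u} [AddCommGroup E] [Module R E]
    (h : ∀ P : Ideal R, P.IsPrime → ∃ J ≤ P, (∃ s ∉ P, ∀ p ∈ P, s * p ∈ J) ∧
      ∀ g : J →ₗ[R] E, ∃ e : E, ∀ j : J, g j = (j : R) • e) :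
    Module.Injective R E := by
  refine Module.injective_of_forall_essential_surjective fun Q _ _ f hf hess ↦ ?_
  rw [← LinearMap.range_eq_top]
  by_contra hne
  have : Nontrivial (Q ⧸ LinearMap.range f) := Submodule.Quotient.nontrivial_iff.mpr hne
  obtain ⟨P, hP⟩ := associatedPrimes.nonempty R (Q ⧸ LinearMap.range f)
  rw [AssociatedPrimes.mem_iff, isAssociatedPrime_iff] at hP
  obtain ⟨hPp, c, hPc⟩ := hP
  obtain ⟨c, rfl⟩ := Submodule.mkQ_surjective _ c
  have hmem : ∀ r : R, r ∈ P ↔ r • c ∈ LinearMap.range f := by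
    intro r
    rw [hPc, Submodule.mem_colon_singleton, Submodule.mem_bot, ← map_smul,
      Submodule.mkQ_apply, Submodule.Quotient.mk_eq_zero]
  obtain ⟨J, hJP, ⟨s, hs, hsP⟩, hext⟩ := h P hPp
  let F := LinearEquiv.ofInjective f hf
  let g : J →ₗ[R] E := F.symm.toLinearMap ∘ₗ
    ((LinearMap.toSpanSingleton R Q c ∘ₗ J.subtype).codRestrict (LinearMap.range f)
      fun j ↦ (hmem j).mp (hJP j.2))
  have hg : ∀ j : J, f (g j) = (j : R) • c := by
    intro j
    have : ((F (g j) : LinearMap.range f) : Q) = (j : R) • c := by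
      simp only [g, LinearMap.comp_apply, LinearEquiv.coe_coe, LinearEquiv.apply_symm_apply]
      rfl
    simpa [F] using this
  obtain ⟨e, he⟩ := hext g
  have hy : ∀ j ∈ J, j • (c - f e) = 0 := by
    intro j hj
    rw [smul_sub, ← hg ⟨j, hj⟩, he ⟨j, hj⟩, map_smul, sub_self]
  have hmem' : ∀ r : R, r • (c - f e) ∈ LinearMap.range f → r ∈ P := by
    intro r hr
    rw [hmem, ← sub_add_cancel c (f e), smul_add]
    exact add_mem hr (Submodule.smul_mem _ _ ⟨e, rfl⟩)
  obtain ⟨r, hr0, hr⟩ := hess (s • (c - f e)) fun h0 ↦ hs (hmem' s (h0 ▸ zero_mem _))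
  rw [smul_smul] at hr0 hr
  rcases hPp.mem_or_mem (hmem' _ hr) with hrP | hsP'
  · exact hr0 (by rw [mul_comm]; exact hy _ (hsP r hrP))
  · exact hs hsP'

/-! ### Regular local rings -/

/-- Steinitz exchange modulo `J`: if no coefficient of `x` were a unit, `x` would lie in `J + m²`.
-/
lemma IsLocalRing.exists_maximalIdeal_eq_sup_span_erase {S : Type*} [CommRing S] [IsLocalRing S]
    [DecidableEq S] {J : Ideal S} {t : Finset S} (ht : maximalIdeal S = J ⊔ Ideal.span t) {x : S}
    (hx : x ∈ maximalIdeal S) (hx' : x ∉ J ⊔ maximalIdeal S ^ 2) :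
    ∃ a ∈ t, maximalIdeal S = J ⊔ Ideal.span {x} ⊔ Ideal.span (t.erase a : Finset S) := by
  have htm : ∀ b ∈ t, b ∈ maximalIdeal S := fun b hb ↦
    ht ▸ Ideal.mem_sup_right (Ideal.subset_span hb)
  obtain ⟨j, hj, w, hw, rfl⟩ := Submodule.mem_sup.mp (ht ▸ hx)
  obtain ⟨d, -, rfl⟩ := Submodule.mem_span_finset.mp hw
  obtain ⟨a, ha, hda⟩ : ∃ a ∈ t, IsUnit (d a) := by
    by_contra! hd
    refine hx' (add_mem (Ideal.mem_sup_left hj) (Ideal.mem_sup_right (sum_mem fun b hb ↦ ?_)))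
    rw [pow_two, smul_eq_mul]
    exact Ideal.mul_mem_mul (hd b hb) (htm b hb)
  refine ⟨a, ha, le_antisymm ?_ ?_⟩
  · set x := j + ∑ b ∈ t, d b • b with hxdef
    set I := J ⊔ Ideal.span {x} ⊔ Ideal.span (t.erase a : Finset S)
    have herase : ∀ b ∈ t.erase a, b ∈ I := fun b hb ↦
      Ideal.mem_sup_right (Ideal.subset_span hb)
    have hJI : J ≤ I := le_sup_left.trans le_sup_left
    have hxI : x ∈ I := Ideal.mem_sup_left (Ideal.mem_sup_right (Ideal.mem_span_singleton_self x))
    have haI : a ∈ I := by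
      rw [← Ideal.unit_mul_mem_iff_mem I hda]
      have : d a * a = x - j - ∑ b ∈ t.erase a, d b • b := by
        rw [hxdef, ← Finset.add_sum_erase t _ ha, smul_eq_mul]
        ring
      rw [this]
      exact sub_mem (sub_mem hxI (hJI hj)) (sum_mem fun b hb ↦ I.mul_mem_left _ (herase b hb))
    rw [ht]
    refine sup_le hJI (Ideal.span_le.mpr fun b hb ↦ ?_)
    by_cases hba : b = a
    · exact hba ▸ haI
    · exact herase b (Finset.mem_erase.mpr ⟨hba, hb⟩)
  · refine sup_le (sup_le (ht ▸ le_sup_left) ?_) (Ideal.span_le.mpr fun b hb ↦ ?_)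
    · rwa [Ideal.span_singleton_le_iff_mem]
    · exact htm b (Finset.mem_of_mem_erase hb)

lemma IsLocalRing.exists_natCast_eq_ringKrullDim (S : Type*) [CommRing S] [IsLocalRing S]
    [IsNoetherianRing S] : ∃ n : ℕ, ringKrullDim S = n := by
  obtain ⟨n, hn⟩ := ENat.ne_top_iff_exists.mp
    (Ideal.height_ne_top (maximalIdeal.isMaximal S).ne_top)
  exact ⟨n, by rw [← maximalIdeal_height_eq_ringKrullDim, ← hn]; rfl⟩

/-- Killing `x` lowers the embedding dimension by at least one and the Krull dimension by at most
one. -/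
lemma IsRegularLocalRing.quotient_span_singleton {S : Type*} [CommRing S] [IsRegularLocalRing S]
    {x : S} (hx : x ∈ maximalIdeal S) (hx' : x ∉ maximalIdeal S ^ 2) :
    IsRegularLocalRing (S ⧸ Ideal.span {x}) ∧
      (maximalIdeal S).spanFinrank = ringKrullDim (S ⧸ Ideal.span {x}) + 1 := by
  classical
  have : Nontrivial (S ⧸ Ideal.span {x}) := Ideal.Quotient.nontrivial_iff.mpr
    (by rw [Ne, Ideal.span_singleton_eq_top]; exact hx)
  have : IsLocalRing (S ⧸ Ideal.span {x}) :=
    .of_surjective' (Ideal.Quotient.mk _) Ideal.Quotient.mk_surjective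
  obtain ⟨t, htc, ht⟩ := (IsNoetherian.noetherian
    (maximalIdeal S)).exists_span_finset_card_eq_spanFinrank
  obtain ⟨a, ha, hm⟩ := exists_maximalIdeal_eq_sup_span_erase (J := ⊥) (t := t)
    (by rw [bot_sup_eq]; exact ht.symm) hx (by rwa [bot_sup_eq])
  rw [bot_sup_eq] at hm
  have hmap : maximalIdeal (S ⧸ Ideal.span {x}) =
      Ideal.span ((t.erase a).image (Ideal.Quotient.mk (Ideal.span {x})) : Finset _) := by
    have hsurj := Ideal.Quotient.mk_surjective (I := Ideal.span {x})
    have := eq_maximalIdeal (Ideal.comap_isMaximal_of_surjective _ hsurj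
      (K := maximalIdeal (S ⧸ Ideal.span {x})))
    rw [← Ideal.map_comap_of_surjective _ hsurj (maximalIdeal _), this,
      hm, Ideal.map_sup, Ideal.map_span, Ideal.map_span]
    simp
  have hrank : (maximalIdeal (S ⧸ Ideal.span {x})).spanFinrank + 1 ≤
      (maximalIdeal S).spanFinrank := by
    rw [← htc, ← Finset.card_erase_add_one ha, hmap]
    gcongr
    refine (Submodule.spanFinrank_span_le_ncard_of_finite (Finset.finite_toSet _)).trans ?_
    rw [Set.ncard_coe_finset]
    exact Finset.card_image_le
  have hdim : ringKrullDim S ≤ ringKrullDim (S ⧸ Ideal.span {x}) + 1 := by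
    rw [← maximalIdeal_height_eq_ringKrullDim]
    exact Ideal.height_le_ringKrullDim_quotient_add_one hx
  rw [← IsRegularLocalRing.spanFinrank_maximalIdeal] at hdim
  have hle := ringKrullDim_le_spanFinrank_maximalIdeal (S ⧸ Ideal.span {x})
  obtain ⟨n, hn⟩ := exists_natCast_eq_ringKrullDim (S ⧸ Ideal.span {x})
  rw [hn] at hdim hle ⊢
  norm_cast at hdim hle ⊢
  refine ⟨.of_spanFinrank_maximalIdeal_le _ ?_, by lia⟩
  rw [hn]
  norm_cast
  lia

lemma IsRegularLocalRing.exists_mem_maximalIdeal_notMem_sq {S : Type*} [CommRing S]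
    [IsRegularLocalRing S] (h : maximalIdeal S ≠ ⊥) :
    ∃ x ∈ maximalIdeal S, x ∉ maximalIdeal S ^ 2 ∧ ∀ q ∈ minimalPrimes S, x ∉ q := by
  have hfin : (insert (maximalIdeal S ^ 2) (minimalPrimes S)).Finite :=
    (minimalPrimes.finite_of_isNoetherianRing S).insert _
  by_contra! hcon
  -- Prime avoidance tolerates two non-prime members; `m²` fills both slots.
  obtain ⟨I, hI, hle⟩ := (Ideal.subset_union_prime_finite hfin (f := id) (maximalIdeal S ^ 2)
    (maximalIdeal S ^ 2) (I := maximalIdeal S) (fun i hi hne _ ↦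
      (Set.mem_of_mem_insert_of_ne hi hne).1.1)).mp fun x hx ↦ by
    by_cases hx2 : x ∈ maximalIdeal S ^ 2
    · exact Set.mem_biUnion (Set.mem_insert _ _) hx2
    · obtain ⟨q, hq, hxq⟩ := hcon x hx hx2
      exact Set.mem_biUnion (Set.mem_insert_of_mem _ hq) hxq
  rcases hI with rfl | hI
  · refine h (Submodule.eq_bot_of_le_smul_of_le_jacobson_bot (maximalIdeal S) _
      (IsNoetherian.noetherian _) ?_ (maximalIdeal_le_jacobson _))
    simpa [pow_two] using hle
  · have hIm : I = maximalIdeal S := le_antisymm (le_maximalIdeal hI.1.1.ne_top) hle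
    have := hI.1.1
    have h0 : (maximalIdeal S).height = 0 := by
      rw [← hIm]
      exact Ideal.height_eq_zero_iff.mpr hI
    have := IsRegularLocalRing.spanFinrank_maximalIdeal (R := S)
    rw [← maximalIdeal_height_eq_ringKrullDim, h0] at this
    norm_cast at this
    exact h ((Submodule.spanFinrank_eq_zero_iff_eq_bot (IsNoetherian.noetherian _)).mp this)

lemma IsLocalRing.isDomain_of_span_singleton_isPrime {S : Type*} [CommRing S] [IsLocalRing S]
    [IsNoetherianRing S] {x : S} (hx : x ∈ maximalIdeal S) [hp : (Ideal.span {x}).IsPrime]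
    (hq : ∀ q ∈ minimalPrimes S, x ∉ q) : IsDomain S := by
  obtain ⟨q, hqm, hqx⟩ := Ideal.exists_minimalPrimes_le (bot_le : ⊥ ≤ Ideal.span {x})
  -- An element `x z` of `q` has `z ∈ q`, since `x ∉ q`; so `q ≤ m q`, and Nakayama applies.
  have hq0 : q = ⊥ := by
    refine Submodule.eq_bot_of_le_smul_of_le_jacobson_bot (maximalIdeal S) _
      (IsNoetherian.noetherian _) (fun y hy ↦ ?_) (maximalIdeal_le_jacobson _)
    obtain ⟨z, rfl⟩ := Ideal.mem_span_singleton.mp (hqx hy)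
    exact Ideal.mul_mem_mul hx ((hqm.1.1.mem_or_mem hy).resolve_left (hq q hqm))
  have := hqm.1.1
  rw [hq0] at this
  exact IsDomain.of_bot_isPrime S

theorem IsRegularLocalRing.isDomain (S : Type*) [CommRing S] [IsRegularLocalRing S] :
    IsDomain S := by
  induction hn : (maximalIdeal S).spanFinrank using Nat.strong_induction_on generalizing S with
  | h n ih =>
  by_cases h : maximalIdeal S = ⊥
  · exact (isField_iff_maximalIdeal_eq.mpr h).isDomain
  · obtain ⟨x, hx, hx2, hq⟩ := exists_mem_maximalIdeal_notMem_sq h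
    obtain ⟨hreg, hdim⟩ := quotient_span_singleton hx hx2
    rw [← hreg.spanFinrank_maximalIdeal] at hdim
    norm_cast at hdim
    have := ih _ (by lia) (S ⧸ Ideal.span {x}) rfl
    have : (Ideal.span {x}).IsPrime := (Ideal.Quotient.isDomain_iff_prime _).mp this
    exact isDomain_of_span_singleton_isPrime hx hq

theorem IsRegularLocalRing.exists_isRegular (S : Type*) [CommRing S] [IsRegularLocalRing S] :
    ∃ rs : List S, rs.length = ringKrullDim S ∧ (∀ r ∈ rs, r ∈ maximalIdeal S) ∧
      IsRegular S rs := by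
  induction hn : (maximalIdeal S).spanFinrank using Nat.strong_induction_on generalizing S with
  | h n ih =>
  by_cases h : maximalIdeal S = ⊥
  · refine ⟨[], ?_, by simp, .nil S S⟩
    rw [← IsRegularLocalRing.spanFinrank_maximalIdeal, h]
    simp
  · obtain ⟨x, hx, hx2, -⟩ := exists_mem_maximalIdeal_notMem_sq h
    obtain ⟨hreg, hdim⟩ := quotient_span_singleton hx hx2
    have hlt := hdim
    rw [← hreg.spanFinrank_maximalIdeal] at hlt
    norm_cast at hlt
    obtain ⟨rs, hlen, hmem, hrs⟩ := ih _ (by lia) (S ⧸ Ideal.span {x}) rfl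
    have := IsRegularLocalRing.isDomain S
    obtain ⟨rs, rfl⟩ := List.map_surjective_iff.mpr Ideal.Quotient.mk_surjective rs
    have hx0 : x ≠ 0 := by
      rintro rfl
      exact hx2 (zero_mem _)
    have hcomap : ∀ r, Ideal.Quotient.mk (Ideal.span {x}) r ∈ maximalIdeal _ →
        r ∈ maximalIdeal S := fun r hr hu ↦ hr (hu.map _)
    have hmem' : ∀ r ∈ x :: rs, r ∈ maximalIdeal S := by
      simp only [List.mem_cons, forall_eq_or_imp]
      exact ⟨hx, fun r hr ↦ hcomap r (hmem _ (List.mem_map_of_mem hr))⟩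
    refine ⟨x :: rs, ?_, hmem', .of_isWeaklyRegular_of_mem_maximalIdeal S hmem' ?_⟩
    · rw [← IsRegularLocalRing.spanFinrank_maximalIdeal, hdim, ← hlen]
      simp
    · rw [isWeaklyRegular_cons_iff]
      refine ⟨IsSMulRegular.of_right_eq_zero_of_smul fun y hy ↦ by simpa [hx0] using hy, ?_⟩
      have h1 := (isWeaklyRegular_map_algebraMap_iff (S ⧸ Ideal.span {x}) (S ⧸ Ideal.span {x})
        rs).mp hrs.toIsWeaklyRegular
      refine (LinearEquiv.isWeaklyRegular_congr (Submodule.quotEquivOfEq _ _ ?_) rs).mp h1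
      rw [← Submodule.ideal_span_singleton_smul, smul_eq_mul, Ideal.mul_top]

/-! ### Depth and associated primes -/

/-- Rees's dimension shift: by the long exact sequence for multiplication by `x`, each quotient
costs one degree of Ext vanishing. -/
lemma RingTheory.Sequence.IsWeaklyRegular.subsingleton_hom_of_subsingleton_ext {R : Type u}
    [CommRing R] (N : ModuleCat.{u} R) (n : ℕ) (rs : List R) (M : ModuleCat.{u} R)
    (hrs : IsWeaklyRegular M rs) (hn : rs.length < n)
    (hext : ∀ i < n, Subsingleton (Ext N M i)) :
    Subsingleton (N →ₗ[R] M ⧸ (Ideal.ofList rs • ⊤ : Submodule R M)) := by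
  induction rs generalizing M n with
  | nil =>
    have : Subsingleton (N ⟶ M) := Ext.addEquiv₀.subsingleton_congr.mp (hext 0 hn)
    have : Subsingleton (N →ₗ[R] M) := ModuleCat.homAddEquiv.symm.subsingleton
    exact (LinearEquiv.congrRight (Submodule.quotEquivOfEqBot _ (by simp)) :
      (N →ₗ[R] _) ≃ₗ[R] (N →ₗ[R] M)).toEquiv.subsingleton
  | cons x rs ih =>
    rw [isWeaklyRegular_cons_iff] at hrs
    obtain ⟨n, rfl⟩ : ∃ m, n = m + 1 := ⟨n - 1, by lia⟩
    have := ih n (ModuleCat.of R (QuotSMulTop x M)) hrs.2 (by simpa using hn) fun i hi ↦ by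
      have zero1 := AddCommGrpCat.isZero_of_iff_subsingleton.mpr (hext i (by lia))
      have zero2 := AddCommGrpCat.isZero_of_iff_subsingleton.mpr (hext (i + 1) (by lia))
      exact AddCommGrpCat.subsingleton_of_isZero <| ShortComplex.Exact.isZero_of_both_zeros
        ((Ext.covariant_sequence_exact₃' N hrs.1.smulShortComplex_shortExact) i (i + 1) rfl)
        (zero1.eq_zero_of_src _) (zero2.eq_zero_of_tgt _)
    exact (LinearEquiv.congrRight
      (Submodule.quotOfListConsSMulTopEquivQuotSMulTopInner M x rs)).toEquiv.subsingleton

theorem IsRegularLocalRing.mem_ofList_of_maximalIdeal_mul_le {S : Type u} [CommRing S]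
    [IsRegularLocalRing S] {xs : List S} (hxs : IsWeaklyRegular S xs)
    (hlt : (xs.length : WithBot ℕ∞) < ringKrullDim S) {y : S}
    (hy : ∀ a ∈ maximalIdeal S, a * y ∈ Ideal.ofList xs) : y ∈ Ideal.ofList xs := by
  obtain ⟨rs, hlen, hmem, hrs⟩ := exists_isRegular S
  rw [← hlen] at hlt
  have hss := hxs.subsingleton_hom_of_subsingleton_ext (ModuleCat.of S (S ⧸ maximalIdeal S))
    rs.length (M := ModuleCat.of S S) (hn := by exact_mod_cast hlt)
    (hext := ModuleCat.subsingleton_ext_of_exists_isRegular (maximalIdeal S) _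
      (by
        rw [Module.support_eq_zeroLocus, Ideal.annihilator_quotient])
      _ (by
        rw [smul_eq_mul, Ideal.mul_top]
        exact lt_top_iff_ne_top.mpr (maximalIdeal.isMaximal S).ne_top) rs hmem hrs)
  -- The socle element `y` defines a map out of the residue field, which must vanish.
  let φ : (S ⧸ maximalIdeal S) →ₗ[S] S ⧸ (Ideal.ofList xs • ⊤ : Submodule S S) :=
    (maximalIdeal S).liftQ (LinearMap.toSpanSingleton S _ (Submodule.Quotient.mk y)) fun a ha ↦ by
      rw [LinearMap.mem_ker, LinearMap.toSpanSingleton_apply, ← Submodule.Quotient.mk_smul,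
        Submodule.Quotient.mk_eq_zero]
      simpa using hy a ha
  have hφ : φ (Submodule.Quotient.mk 1) = 0 := by
    rw [show φ = 0 from Subsingleton.elim (α := _ →ₗ[S] _) φ 0, LinearMap.zero_apply]
  rw [Submodule.liftQ_apply, LinearMap.toSpanSingleton_apply, one_smul,
    Submodule.Quotient.mk_eq_zero] at hφ
  simpa using hφ

/-! ### Regular sequences generating a prime locally -/

lemma IsLocalization.AtPrime.exists_notMem_mul_mem {R : Type*} [CommRing R] (P : Ideal R)
    [P.IsPrime] (S : Type*) [CommRing S] [Algebra R S] [IsLocalization.AtPrime S P] {J : Ideal R}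
    {y : R} (hy : algebraMap R S y ∈ J.map (algebraMap R S)) : ∃ s ∉ P, s * y ∈ J := by
  obtain ⟨⟨j, s⟩, h⟩ := (IsLocalization.mem_map_algebraMap_iff P.primeCompl S).mp hy
  rw [← map_mul] at h
  obtain ⟨c, hc⟩ := (IsLocalization.eq_iff_exists P.primeCompl S).mp h
  refine ⟨c * s, (c * s).2, ?_⟩
  rw [mul_assoc, mul_comm _ y, hc]
  exact J.mul_mem_left _ j.2

lemma IsLocalization.AtPrime.exists_notMem_forall_mul_mem {R : Type*} [CommRing R] (P : Ideal R)
    [P.IsPrime] (S : Type*) [CommRing S] [Algebra R S] [IsLocalization.AtPrime S P] {I J : Ideal R}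
    (hI : I.FG) (h : I.map (algebraMap R S) ≤ J.map (algebraMap R S)) :
    ∃ s ∉ P, ∀ p ∈ I, s * p ∈ J := by
  obtain ⟨t, rfl⟩ := hI
  have hex : ∀ y ∈ t, ∃ s ∉ P, s * y ∈ J := fun y hy ↦
    exists_notMem_mul_mem P S (h (Ideal.mem_map_of_mem _ (Ideal.subset_span hy)))
  choose! s hsP hsJ using hex
  refine ⟨∏ y ∈ t, s y, fun hmem ↦ ?_, fun p hp ↦ ?_⟩
  · obtain ⟨y, hy, hyP⟩ := (Ideal.IsPrime.prod_mem_iff).mp hmem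
    exact hsP y hy hyP
  · have hle : Ideal.span (t : Set R) ≤ Submodule.comap (LinearMap.mulLeft R (∏ y ∈ t, s y)) J := by
      refine Ideal.span_le.mpr fun y hy ↦ ?_
      obtain ⟨c, hc⟩ := Finset.dvd_prod_of_mem s hy
      change (∏ y ∈ t, s y) * y ∈ J
      rw [hc, mul_right_comm]
      exact J.mul_mem_right _ (hsJ y hy)
    exact hle hp

/-- If `P ≤ Q`, then `xs` is shorter than `dim R_Q`, so `R_Q/(xs)` has no socle, whereas `Q` being
associated provides one. -/
lemma IsRegularRing.not_le_of_mem_associatedPrimes {R : Type u} [CommRing R] [IsRegularRing R]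
    {P Q : Ideal R} [P.IsPrime] {xs : List R} (hxs : IsWeaklyRegular R xs)
    (hlt : (xs.length : ℕ∞) < P.height) (hQ : Q ∈ associatedPrimes R (R ⧸ Ideal.ofList xs)) :
    ¬ P ≤ Q := by
  intro hPQ
  rw [AssociatedPrimes.mem_iff, isAssociatedPrime_iff] at hQ
  obtain ⟨hQp, y, hy⟩ := hQ
  obtain ⟨y, rfl⟩ := Submodule.mkQ_surjective _ y
  have hmem : ∀ r : R, r ∈ Q ↔ r * y ∈ Ideal.ofList xs := by
    intro r
    rw [hy, Submodule.mem_colon_singleton, Submodule.mem_bot, ← map_smul,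
      Submodule.mkQ_apply, Submodule.Quotient.mk_eq_zero, smul_eq_mul]
  let S := Localization.AtPrime Q
  have hreg : IsWeaklyRegular S (xs.map (algebraMap R S)) :=
    hxs.of_isLocalization S Q.primeCompl
  have hdim : ((xs.map (algebraMap R S)).length : WithBot ℕ∞) < ringKrullDim S := by
    rw [List.length_map, IsLocalization.AtPrime.ringKrullDim_eq_height Q S]
    exact_mod_cast hlt.trans_le (Ideal.height_mono hPQ)
  have hyS : algebraMap R S y ∈ (Ideal.ofList xs).map (algebraMap R S) := by
    rw [Ideal.map_ofList]
    refine IsRegularLocalRing.mem_ofList_of_maximalIdeal_mul_le hreg hdim fun a ha ↦ ?_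
    rw [← Ideal.map_ofList]
    rw [← Localization.AtPrime.map_eq_maximalIdeal] at ha
    have hle : (Q.map (algebraMap R S)) * Ideal.span {algebraMap R S y} ≤
        (Ideal.ofList xs).map (algebraMap R S) := by
      rw [← Set.image_singleton, ← Ideal.map_span, ← Ideal.map_mul]
      refine Ideal.map_mono (Ideal.mul_le.mpr fun r hr z hz ↦ ?_)
      obtain ⟨c, rfl⟩ := Ideal.mem_span_singleton.mp hz
      rw [← mul_assoc]
      exact Ideal.mul_mem_right _ _ ((hmem r).mp hr)
    exact hle (Ideal.mul_mem_mul ha (Ideal.mem_span_singleton_self _))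
  obtain ⟨s, hs, hsy⟩ := IsLocalization.AtPrime.exists_notMem_mul_mem Q S hyS
  exact hs ((hmem s).mpr hsy)

lemma IsLocalRing.not_maximalIdeal_le_ofList_sup_sq {S : Type*} [CommRing S]
    [IsLocalRing S] [IsNoetherianRing S] {xs : List S} (hxs : ∀ x ∈ xs, x ∈ maximalIdeal S)
    (hlt : (xs.length : WithBot ℕ∞) < ringKrullDim S) :
    ¬ maximalIdeal S ≤ Ideal.ofList xs ⊔ maximalIdeal S ^ 2 := by
  classical
  intro hle
  have hle' : maximalIdeal S ≤ Ideal.ofList xs :=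
    Submodule.le_of_le_smul_of_le_jacobson_bot (IsNoetherian.noetherian _)
      (maximalIdeal_le_jacobson _) (by rwa [smul_eq_mul, ← pow_two])
  have heq : maximalIdeal S = Ideal.ofList xs := le_antisymm hle' (Ideal.span_le.mpr hxs)
  have h1 := ringKrullDim_le_spanFinrank_maximalIdeal S
  have h2 : (maximalIdeal S).spanFinrank ≤ xs.length := by
    have hset : {r | r ∈ xs} = (xs.toFinset : Set S) := by ext; simp
    rw [heq, Ideal.ofList, hset]
    refine (Submodule.spanFinrank_span_le_ncard_of_finite (Finset.finite_toSet _)).trans ?_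
    rw [Set.ncard_coe_finset]
    exact List.toFinset_card_le xs
  exact absurd (hlt.trans_le h1) (not_lt.mpr (by exact_mod_cast h2))

/-- The set `t` holds the generators of the maximal ideal not yet exchanged for members of `xs`; it
is empty once `i = ht P`. -/
lemma IsRegularRing.exists_isWeaklyRegular_sup_span {R : Type u} [CommRing R] [IsRegularRing R]
    (P : Ideal R) [P.IsPrime] (i : ℕ) (hi : (i : ℕ∞) ≤ P.height) :
    ∃ xs : List R, xs.length = i ∧ (∀ x ∈ xs, x ∈ P) ∧ IsWeaklyRegular R xs ∧
      ∃ t : Finset (Localization.AtPrime P), (t.card + i : ℕ) = P.height ∧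
        maximalIdeal (Localization.AtPrime P) =
          (Ideal.ofList xs).map (algebraMap R (Localization.AtPrime P)) ⊔ Ideal.span t := by
  classical
  let S := Localization.AtPrime P
  induction i with
  | zero =>
    obtain ⟨t, htc, ht⟩ := (IsNoetherian.noetherian
      (maximalIdeal S)).exists_span_finset_card_eq_spanFinrank
    refine ⟨[], rfl, by simp, by simp, t, ?_, ?_⟩
    · have := (IsRegularRing.isRegularLocalRing_localization P).spanFinrank_maximalIdeal
      rw [IsLocalization.AtPrime.ringKrullDim_eq_height P S, ← htc] at this
      exact_mod_cast this
    · simpa using ht.symm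
  | succ i ih =>
    have hlt : (i : ℕ∞) < P.height := lt_of_lt_of_le (by exact_mod_cast i.lt_succ_self) hi
    obtain ⟨xs, hlen, hxP, hxs, t, htc, ht⟩ := ih hlt.le
    set J := Ideal.ofList xs
    -- Avoiding `A` permits the exchange step; avoiding the associated primes of `R ⧸ J` keeps the
    -- sequence regular.
    let A := (J.map (algebraMap R S) ⊔ maximalIdeal S ^ 2).comap (algebraMap R S)
    have hfin : (insert A (associatedPrimes R (R ⧸ J))).Finite :=
      (associatedPrimes.finite R (R ⧸ J)).insert _
    obtain ⟨x, hx, hxA, hxQ⟩ : ∃ x ∈ P, x ∉ A ∧ ∀ Q ∈ associatedPrimes R (R ⧸ J), x ∉ Q := by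
      by_contra! hcon
      obtain ⟨I, hI, hle⟩ := (Ideal.subset_union_prime_finite hfin (f := id) A A (I := P)
        (fun i hi hne _ ↦ (Set.mem_of_mem_insert_of_ne hi hne).1)).mp fun x hx ↦ by
        by_cases hxA : x ∈ A
        · exact Set.mem_biUnion (Set.mem_insert _ _) hxA
        · obtain ⟨q, hq, hxq⟩ := hcon x hx hxA
          exact Set.mem_biUnion (Set.mem_insert_of_mem _ hq) hxq
      rcases hI with rfl | hI
      · rw [id, ← Ideal.map_le_iff_le_comap, Localization.AtPrime.map_eq_maximalIdeal,
          Ideal.map_ofList] at hle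
        refine not_maximalIdeal_le_ofList_sup_sq ?_ ?_ hle
        · simp only [List.mem_map, forall_exists_index, and_imp, forall_apply_eq_imp_iff₂]
          intro a ha
          rw [← Localization.AtPrime.map_eq_maximalIdeal]
          exact Ideal.mem_map_of_mem _ (hxP a ha)
        · rw [List.length_map, IsLocalization.AtPrime.ringKrullDim_eq_height P S, hlen]
          exact_mod_cast hlt
      · exact not_le_of_mem_associatedPrimes hxs (hlen ▸ hlt) hI hle
    obtain ⟨a, ha, hm⟩ := exists_maximalIdeal_eq_sup_span_erase ht
      (x := algebraMap R S x) (by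
        rw [← Localization.AtPrime.map_eq_maximalIdeal]
        exact Ideal.mem_map_of_mem _ hx) hxA
    refine ⟨xs ++ [x], by simp [hlen], ?_, ?_, t.erase a, ?_, ?_⟩
    · simp only [List.mem_append, List.mem_singleton]
      rintro b (hb | rfl)
      exacts [hxP b hb, hx]
    · rw [isWeaklyRegular_append_iff, isWeaklyRegular_singleton_iff]
      refine ⟨hxs, ?_⟩
      have hJ : Ideal.ofList xs • (⊤ : Submodule R R) = J := by simp [J]
      rw [hJ]
      refine IsSMulRegular.of_right_eq_zero_of_smul fun z hz ↦ ?_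
      by_contra hz0
      have : x ∈ ⋃ Q ∈ associatedPrimes R (R ⧸ J), (Q : Set R) := by
        rw [biUnion_associatedPrimes_eq_zero_divisors]
        exact ⟨z, hz0, hz⟩
      simp only [Set.mem_iUnion] at this
      obtain ⟨Q, hQ, hxQ'⟩ := this
      exact hxQ Q hQ hxQ'
    · rw [← htc, ← Finset.card_erase_add_one ha]
      norm_cast
      ring
    · rw [hm, Ideal.ofList_append, Ideal.ofList_singleton, Ideal.map_sup, Ideal.map_span _ {x},
        Set.image_singleton]

theorem IsRegularRing.exists_isRegular_of_isPrime {R : Type u} [CommRing R] [IsRegularRing R]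
    (P : Ideal R) [P.IsPrime] :
    ∃ xs : List R, IsRegular R xs ∧ Ideal.ofList xs ≤ P ∧
      ∃ s ∉ P, ∀ p ∈ P, s * p ∈ Ideal.ofList xs := by
  obtain ⟨n, hn⟩ := ENat.ne_top_iff_exists.mp (Ideal.height_ne_top (I := P) Ideal.IsPrime.ne_top')
  obtain ⟨xs, -, hxP, hxs, t, htc, ht⟩ := exists_isWeaklyRegular_sup_span P n hn.le
  have ht0 : t = ∅ := by
    rw [← hn] at htc
    norm_cast at htc
    exact Finset.card_eq_zero.mp (by lia)
  have hle : Ideal.ofList xs ≤ P := Ideal.span_le.mpr hxP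
  refine ⟨xs, ⟨hxs, fun h ↦ ?_⟩, hle, ?_⟩
  · rw [smul_eq_mul, Ideal.mul_top] at h
    exact Ideal.IsPrime.ne_top' (top_le_iff.mp (h.le.trans hle))
  · refine IsLocalization.AtPrime.exists_notMem_forall_mul_mem P (Localization.AtPrime P)
      (IsNoetherian.noetherian P) ?_
    rw [Localization.AtPrime.map_eq_maximalIdeal, ht, ht0]
    simp

theorem lemma2 {R : Type u} [CommRing R] [IsRegularRing R]
    {E : Type u} [AddCommGroup E] [Module R E]
    (hE : ∀ J : Ideal R,
      (∃ rs : List R, RingTheory.Sequence.IsRegular R rs ∧ J = Ideal.ofList rs) →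
      Subsingleton (CategoryTheory.Abelian.Ext (ModuleCat.of R (R ⧸ J)) (ModuleCat.of R E) 1)) :
    Module.Injective R E := by
  refine Module.injective_of_forall_prime_exists_ideal fun P hP ↦ ?_
  obtain ⟨xs, hxs, hle, hs⟩ := IsRegularRing.exists_isRegular_of_isPrime P
  exact ⟨Ideal.ofList xs, hle, hs,
    Ideal.exists_smul_eq_of_subsingleton_ext _ (hE _ ⟨xs, hxs, rfl⟩)⟩
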